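/- Let $M$ be a matroid on a finite ground set, and let $\mathcal{B}$ be its set of bases. The bases exchange graph $G_M$ is the simple graph with vertex set $\mathcal{B}$ in which two bases $B, B'$ are adjacent if and only if $|B \,\Delta\, B'| = 2$. For a finite graph $G=(V,E)$ and a nonempty set $S\subseteq V$ put $\overline{S}=V\setminus S$, let $E(S,\overline{S})$ be the set of edges with one endpoint in $S$ and the other in $\overline{S}$, and define $$h(S)=\frac{|E(S,\overline{S})|}{|S|},\qquad h(G)=\min_{\emptyset\neq S\subseteq V,\ |S|\le|\overline{S}|} h(S),$$ where the minimum over the empty family (which occurs only if $|V|\le 1$) is $+\infty$. Then for every matroid $M$ on a finite ground set, the expansion of its bases exchange graph is at least $1$: $h(G_M)\ge 1$. That is, $|E(S,\overline{S})|\ge|S|$ for every set $S\subseteq\mathcal{B}$ of bases with $|S|\le|\mathcal{B}\setminus S|$. -/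

import Mathlib

open scoped NNReal ENNReal symmDiff

/-- The set `E(S, Sᶜ)` of edges of `G` with one endpoint in `S` and the other one outside `S`. -/
def SimpleGraph.cutEdges {V : Type*} (G : SimpleGraph V) (S : Set V) : Set (Sym2 V) :=
  {e | e ∈ G.edgeSet ∧ ∃ u ∈ S, ∃ v ∈ Sᶜ, e = s(u, v)}

/-- The expansion `|E(S, Sᶜ)| / |S|` of a (nonempty) set `S` of vertices of a finite graph. -/
noncomputable def SimpleGraph.setExpansion {V : Type*} [Finite V] (G : SimpleGraph V)
    (S : Set V) : ℝ≥0 :=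
  ((G.cutEdges S).ncard : ℝ≥0) / (S.ncard : ℝ≥0)

/-- The expansion of a finite graph: the minimum of the expansion of `S` over all nonempty sets
`S` of vertices with `|S| ≤ |Sᶜ|`. The value is `⊤` if there is no such set, that is, if the graph
has at most one vertex. -/
noncomputable def SimpleGraph.expansion {V : Type*} [Finite V] (G : SimpleGraph V) : ℝ≥0∞ :=
  ⨅ (S : Set V) (_ : S.Nonempty) (_ : S.ncard ≤ Sᶜ.ncard), (G.setExpansion S : ℝ≥0∞)

/-- The bases exchange graph of a matroid: its vertices are the bases, and `B`, `B'` are adjacent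
iff `|B ∆ B'| = 2`. -/
def Matroid.basesExchangeGraph {α : Type*} (M : Matroid α) :
    SimpleGraph {B : Set α // M.IsBase B} where
  Adj B B' := ((B : Set α) ∆ (B' : Set α)).encard = 2
  symm := ⟨fun B B' h => by rwa [symmDiff_comm]⟩
  loopless := ⟨fun B h => by simp at h⟩

/-- A matroid on a finite ground set has finitely many bases. -/
instance Matroid.finite_bases {α : Type*} (M : Matroid α) [M.Finite] :
    Finite {B : Set α // M.IsBase B} :=
  (M.ground_finite.finite_subsets.subset fun _ hB => M.subset_ground _ hB).to_subtype

/-! The proof is spectral. Let r be the rank. The core is the Poincaré inequality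
`IsBaseFamily.var_le_sum_var`: the count-weighted variance of f over all bases is at most the sum,
over sets J of size r - 1, of its variances over the bases containing J. Take f to be the indicator
of S. The left side is |S| |Sᶜ| / |𝓑| ≥ |S| / 2. A set J lying in s bases of S and t other bases
contributes st / (s + t) ≤ st / 2, and a pair (B, B') across the cut is counted only at J = B ∩ B',
so the right side is at most half the cut.

The Poincaré inequality is built one element at a time (`IsBaseFamily.mul_var_le_sum_var_insert`).
By the law of total variance each step says that averaging from bases to elements contracts
functions of mean zero (`IsBaseFamily.sum_sq_div_deg_le`). By duality this follows once the
pair-count matrix `adj` is negative semidefinite on vectors orthogonal to `deg`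
(`IsBaseFamily.quadForm_adj_nonpos`).

That is proved by induction on the corank of I, in the manner of Oppenheim's trickling-down theorem.
In corank two, parallelism is an equivalence relation on the non-loops, so `adj` is complete
multipartite. In higher corank, the bounds for the links I ∪ {k} add up to P ≤ P ^ 2 for the walk P
at I. Its eigenvalues are then ≤ 0 or ≥ 1, and by connectedness those ≥ 1 belong to constants
(`quadForm_nonpos_of_le_sq`). -/

/-! ### Linear algebra -/

/-- Positivity of a partial equivalence relation `R`, and the Cauchy–Schwarz inequality for it. -/
theorem sq_sum_rel_le {ι : Type*} [Fintype ι] (R : ι → ι → Prop) [DecidableRel R]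
    (hs : ∀ i j, R i j → R j i) (ht : ∀ i j k, R i j → R j k → R i k) (x : ι → ℝ) :
    0 ≤ (∑ i, ∑ j, if R i j then x i * x j else 0) ∧
    (∑ i, ∑ j, if R i j then x j else 0) ^ 2 ≤
      (∑ i, ∑ j, if R i j then (1 : ℝ) else 0) *
        ∑ i, ∑ j, if R i j then x i * x j else 0 := by
  set e : ι → ℝ := fun i => ∑ j, if R i j then (1 : ℝ) else 0 with he
  set s : ι → ℝ := fun i => ∑ j, if R i j then x j else 0 with hsd
  have e0 : ∀ i, 0 ≤ e i := fun i => Finset.sum_nonneg fun j _ => by split_ifs <;> norm_num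
  have ecl : ∀ i j, R i j → e i = e j := fun i j h => Finset.sum_congr rfl fun k _ => by
    have : R i k ↔ R j k := ⟨fun h' => ht _ _ _ (hs _ _ h) h', fun h' => ht _ _ _ h h'⟩
    simp only [this]
  have epos : ∀ i j, R i j → 0 < e i := fun i j h =>
    Finset.sum_pos' (fun j _ => by split_ifs <;> norm_num) ⟨j, Finset.mem_univ _, by simp [h]⟩
  -- `e i` is the size of the class of i and `s i` the sum of x over it, so a class C contributes
  -- |C| equal terms. An index related to nothing contributes 0 / 0 = 0.
  have key : ∑ i, s i ^ 2 / e i = ∑ i, ∑ j, if R i j then x i * x j else 0 := by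
    have h1 : ∀ i, s i ^ 2 / e i =
        ∑ j, ∑ k, if R j k then (if R j i then x j * x k / e j else 0) else 0 := by
      intro i
      rw [sq, hsd, Finset.sum_mul_sum, Finset.sum_div]
      refine Finset.sum_congr rfl fun j _ => ?_
      rw [Finset.sum_div]
      refine Finset.sum_congr rfl fun k _ => ?_
      by_cases hij : R i j
      · have hji := hs _ _ hij
        by_cases hik : R i k
        · simp [hij, hik, hji, ht _ _ _ hji hik, ecl _ _ hij]
        · have : ¬ R j k := fun h => hik (ht _ _ _ hij h)
          simp [hik, this]
      · have : ¬ R j i := fun h => hij (hs _ _ h)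
        simp [hij, this]
    simp_rw [h1]
    rw [Finset.sum_comm]
    refine Finset.sum_congr rfl fun j _ => ?_
    rw [Finset.sum_comm]
    refine Finset.sum_congr rfl fun k _ => ?_
    split_ifs with hjk
    · have : ∀ i, (if R j i then x j * x k / e j else 0) =
          (x j * x k / e j) * (if R j i then 1 else 0) := fun i => by split_ifs <;> simp
      simp_rw [this]
      rw [← Finset.mul_sum]
      exact div_mul_cancel₀ _ (epos _ _ hjk).ne'
    · simp
  rw [← key]
  refine ⟨Finset.sum_nonneg fun i _ => div_nonneg (sq_nonneg _) (e0 i), ?_⟩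
  have := Finset.sum_sq_le_sum_mul_sum_of_sq_le_mul Finset.univ (r := s) (f := e)
    (g := fun i => s i ^ 2 / e i) (fun i _ => e0 i) (fun i _ => div_nonneg (sq_nonneg _) (e0 i)) ?_
  · exact this
  · intro i _
    refine le_of_eq ?_
    by_cases h : e i = 0
    · have : s i = 0 := Finset.sum_eq_zero fun j _ => by
        have : ¬ R i j := fun h' => (epos _ _ h').ne' h
        simp [this]
      simp [this]
    · field_simp

/-- Let `A` be a symmetric nonnegative matrix with row sums `s * d i`, so that `A i j / (s * d i)`
is a reversible random walk `P`. If `P ≤ P ^ 2` and the walk is connected on the support of `d`,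
then `A` is negative semidefinite on the orthogonal complement of `d`. -/
theorem quadForm_nonpos_of_le_sq {ι : Type*} [Fintype ι] [DecidableEq ι] (A : ι → ι → ℝ)
    (d : ι → ℝ) (s : ℝ) (hsymm : ∀ i j, A i j = A j i) (hA : ∀ i j, 0 ≤ A i j)
    (hd : ∀ i, 0 ≤ d i) (hrow : ∀ i, ∑ j, A i j = s * d i)
    (hsq : ∀ x : ι → ℝ, s * ∑ i, ∑ j, A i j * (x i * x j) ≤ ∑ i, (∑ j, A i j * x j) ^ 2 / d i)
    (hconn : ∀ i j, 0 < d i → 0 < d j → 0 < A i j ∨ ∃ k, 0 < A i k ∧ 0 < A k j)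
    (x : ι → ℝ) (hx : ∑ i, d i * x i = 0) :
    ∑ i, ∑ j, A i j * (x i * x j) ≤ 0 := by
  have hA0 : ∀ i j, d i = 0 → A i j = 0 := fun i j h =>
    (Finset.sum_eq_zero_iff_of_nonneg fun j _ => hA i j).1 (by rw [hrow, h, mul_zero]) j
      (Finset.mem_univ _)
  have hA0' : ∀ i j, d j = 0 → A i j = 0 := fun i j h => by rw [hsymm, hA0 j i h]
  set q : ι → ℝ := fun i => √(d i) with hq
  have hqq : ∀ i, q i * q i = d i := fun i => Real.mul_self_sqrt (hd i)
  have hq0 : ∀ i, d i ≠ 0 → q i ≠ 0 := fun i h => (Real.sqrt_ne_zero (hd i)).2 h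
  -- Conjugating s * P by √d makes it symmetric. Rows with `d i = 0` become zero, since division by
  -- zero gives 0.
  set M : Matrix ι ι ℝ := Matrix.of fun i j => A i j / (q i * q j) with hM
  have hMh : M.IsHermitian := by
    ext i j
    simp [hM, hsymm i j, mul_comm]
  -- The Dirichlet form of the walk.
  have hdir : ∀ z : ι → ℝ, ∑ i, ∑ j, A i j * (z i - z j) ^ 2 =
      2 * (s * ∑ i, d i * z i ^ 2 - ∑ i, ∑ j, A i j * (z i * z j)) := by
    intro z
    have h1 : ∑ i, ∑ j, A i j * z i ^ 2 = s * ∑ i, d i * z i ^ 2 := by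
      simp_rw [← Finset.sum_mul, hrow, Finset.mul_sum, mul_assoc]
    have h2 : ∑ i, ∑ j, A i j * z j ^ 2 = s * ∑ i, d i * z i ^ 2 := by
      rw [Finset.sum_comm, ← h1]
      exact Finset.sum_congr rfl fun i _ => Finset.sum_congr rfl fun j _ => by rw [hsymm]
    calc _ = ∑ i, ∑ j, A i j * z i ^ 2 + ∑ i, ∑ j, A i j * z j ^ 2
          - 2 * ∑ i, ∑ j, A i j * (z i * z j) := by
          simp_rw [Finset.mul_sum, ← Finset.sum_add_distrib, ← Finset.sum_sub_distrib]
          exact Finset.sum_congr rfl fun i _ => Finset.sum_congr rfl fun j _ => by ring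
      _ = _ := by rw [h1, h2]; ring
  set b := hMh.eigenvectorBasis with hb
  set l := hMh.eigenvalues with hl
  -- rescaled eigenvectors
  have hev : ∀ k i, ∑ j, A i j * (b k j / q j) = l k * q i * b k i := by
    intro k i
    have := congrFun (hMh.mulVec_eigenvectorBasis k) i
    simp only [Matrix.mulVec, dotProduct, hM, Matrix.of_apply, Pi.smul_apply, smul_eq_mul] at this
    by_cases h : d i = 0
    · have h' : q i = 0 := by simp [hq, h]
      simp [hA0 i _ h, h']
    · have hqi := hq0 i h
      rw [mul_right_comm, hl, hb, ← this, Finset.sum_mul]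
      refine Finset.sum_congr rfl fun j _ => ?_
      field_simp
  have hbz : ∀ k i, l k ≠ 0 → d i = 0 → b k i = 0 := by
    intro k i hk h
    have := congrFun (hMh.mulVec_eigenvectorBasis k) i
    simp only [Matrix.mulVec, dotProduct, hM, Matrix.of_apply, Pi.smul_apply, smul_eq_mul,
      hA0 i _ h, zero_div, zero_mul, Finset.sum_const_zero] at this
    exact (mul_eq_zero.1 this.symm).resolve_left hk
  have hnorm : ∀ k, ∑ i, b k i ^ 2 = 1 := by
    intro k
    have := b.orthonormal.1 k
    rw [EuclideanSpace.norm_eq, Real.sqrt_eq_one] at this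
    simpa using this
  have hquad : ∀ k, ∑ i, ∑ j, A i j * ((b k i / q i) * (b k j / q j)) = l k := by
    intro k
    have : ∀ i, ∑ j, A i j * ((b k i / q i) * (b k j / q j)) = l k * b k i ^ 2 := by
      intro i
      have : ∑ j, A i j * ((b k i / q i) * (b k j / q j)) =
          (b k i / q i) * ∑ j, A i j * (b k j / q j) := by
        rw [Finset.mul_sum]; exact Finset.sum_congr rfl fun j _ => by ring
      rw [this, hev]
      by_cases h : d i = 0
      · by_cases hk : l k = 0
        · simp [hk]
        · simp [hbz k i hk h]
      · have := hq0 i h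
        field_simp
    simp_rw [this, ← Finset.mul_sum, hnorm, mul_one]
  have hnz : ∀ k, l k ≠ 0 → ∑ i, d i * (b k i / q i) ^ 2 = 1 := by
    intro k hk
    rw [← hnorm k]
    refine Finset.sum_congr rfl fun i _ => ?_
    by_cases h : d i = 0
    · simp [hbz k i hk h]
    · have := hq0 i h
      rw [← hqq]; field_simp
  have hle : ∀ k, s * l k ≤ l k ^ 2 := by
    intro k
    have h := hsq fun i => b k i / q i
    rw [hquad] at h
    refine h.trans ?_
    simp_rw [hev]
    calc _ ≤ ∑ i, l k ^ 2 * b k i ^ 2 := Finset.sum_le_sum fun i _ => by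
          by_cases h : d i = 0
          · rw [h, div_zero]; positivity
          · rw [mul_pow, mul_pow, sq (q i), hqq]
            field_simp; rfl
      _ = _ := by rw [← Finset.mul_sum, hnorm, mul_one]
  -- eigenvectors with positive eigenvalue are constant
  have hmain : ∀ k, 0 < l k → ∑ i, b k i * (q i * x i) = 0 := by
    intro k hk
    set z : ι → ℝ := fun i => b k i / q i with hz
    -- A positive eigenvalue with s * l ≤ l ^ 2 is at least s. The Dirichlet form of z is 2 * (s -
    -- l), so it must vanish.
    have hlk : s ≤ l k := by
      have := hle k
      nlinarith
    have h0 : ∑ i, ∑ j, A i j * (z i - z j) ^ 2 = 0 := by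
      apply le_antisymm
      · rw [hdir, hquad, hnz k hk.ne']; linarith
      · exact Finset.sum_nonneg fun i _ => Finset.sum_nonneg fun j _ =>
          mul_nonneg (hA i j) (sq_nonneg _)
    have hz' : ∀ i j, 0 < A i j → z i = z j := by
      intro i j hij
      have h1 := (Finset.sum_eq_zero_iff_of_nonneg fun i _ => Finset.sum_nonneg fun j _ =>
          mul_nonneg (hA i j) (sq_nonneg (z i - z j))).1 h0 i (Finset.mem_univ _)
      have h2 := (Finset.sum_eq_zero_iff_of_nonneg fun j _ =>
          mul_nonneg (hA i j) (sq_nonneg (z i - z j))).1 h1 j (Finset.mem_univ _)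
      have := (mul_eq_zero.1 h2).resolve_left hij.ne'
      exact sub_eq_zero.1 (pow_eq_zero_iff two_ne_zero |>.1 this)
    have hc : ∀ i j, 0 < d i → 0 < d j → z i = z j := by
      intro i j hi hj
      rcases hconn i j hi hj with h | ⟨k, h1, h2⟩
      · exact hz' _ _ h
      · exact (hz' _ _ h1).trans (hz' _ _ h2)
    have hrew : ∀ i, b k i * (q i * x i) = d i * x i * z i := by
      intro i
      by_cases h : d i = 0
      · simp [hbz k i hk.ne' h, h]
      · have := hq0 i h
        rw [← hqq, hz]; field_simp
    simp_rw [hrew]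
    by_cases hex : ∃ i₀, 0 < d i₀
    · obtain ⟨i₀, h₀⟩ := hex
      have : ∀ i, d i * x i * z i = d i * x i * z i₀ := by
        intro i
        rcases (hd i).eq_or_lt with h | h
        · simp [← h]
        · rw [hc i i₀ h h₀]
      simp_rw [this, ← Finset.sum_mul, hx, zero_mul]
    · push Not at hex
      exact Finset.sum_eq_zero fun i _ => by simp [le_antisymm (hex i) (hd i)]
  -- spectral expansion
  set y : EuclideanSpace ℝ ι := WithLp.toLp 2 fun i => q i * x i with hy
  have hexp : ∀ j, q j * x j = ∑ k, inner ℝ (b k) y * b k j := by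
    intro j
    have := congrArg (fun v : EuclideanSpace ℝ ι => v j) (b.sum_repr' y)
    simpa [hy] using this.symm
  have hAx : ∀ i, ∑ j, A i j * x j = ∑ k, inner ℝ (b k) y * (l k * q i * b k i) := by
    intro i
    simp_rw [← hev, Finset.mul_sum]
    rw [Finset.sum_comm]
    refine Finset.sum_congr rfl fun j _ => ?_
    by_cases h : d j = 0
    · simp [hA0' i j h]
    · have := hq0 j h
      have hxj : x j = (∑ k, inner ℝ (b k) y * b k j) / q j := by rw [← hexp]; field_simp
      rw [hxj, Finset.sum_div, Finset.mul_sum]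
      exact Finset.sum_congr rfl fun k _ => by ring
  have hinner : ∀ k, inner ℝ (b k) y = ∑ i, b k i * (q i * x i) := by
    intro k
    simp [PiLp.inner_apply, hy, mul_comm]
  have : ∑ i, ∑ j, A i j * (x i * x j) = ∑ k, l k * (inner ℝ (b k) y) ^ 2 := by
    calc _ = ∑ i, x i * ∑ j, A i j * x j := Finset.sum_congr rfl fun i _ => by
          rw [Finset.mul_sum]; exact Finset.sum_congr rfl fun j _ => by ring
      _ = ∑ k, ∑ i, l k * inner ℝ (b k) y * (b k i * (q i * x i)) := by
          simp_rw [hAx, Finset.mul_sum]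
          rw [Finset.sum_comm]
          exact Finset.sum_congr rfl fun k _ => Finset.sum_congr rfl fun i _ => by ring
      _ = _ := Finset.sum_congr rfl fun k _ => by
          rw [← Finset.mul_sum, ← hinner]; ring
  rw [this]
  refine Finset.sum_nonpos fun k _ => ?_
  rcases le_or_gt (l k) 0 with h | h
  · exact mul_nonpos_of_nonpos_of_nonneg h (sq_nonneg _)
  · rw [hinner, hmain k h]; simp

/-! ### Counting bases that contain a given set -/

namespace BaseFamily

variable {α : Type*} [DecidableEq α]

/-- The sum of `f` over the members of `𝓑` that contain `I`. -/
noncomputable def sumOver (𝓑 : Finset (Finset α)) (f : Finset α → ℝ) (I : Finset α) : ℝ :=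
  ∑ B ∈ 𝓑 with I ⊆ B, f B

/-- The number of members of `𝓑` that contain `I` and the further element `i`. -/
noncomputable def deg (𝓑 : Finset (Finset α)) (I : Finset α) (i : α) : ℝ :=
  if i ∈ I then 0 else sumOver 𝓑 1 (insert i I)

/-- The number of members of `𝓑` that contain `I` and the further distinct elements `i`, `j`. -/
noncomputable def adj (𝓑 : Finset (Finset α)) (I : Finset α) (i j : α) : ℝ :=
  if i ∈ I then 0 else deg 𝓑 (insert i I) j

/-- The number of elements of `𝓑` containing `I` times the variance of `f` on them. -/
noncomputable def var (𝓑 : Finset (Finset α)) (f : Finset α → ℝ) (I : Finset α) : ℝ :=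
  sumOver 𝓑 (fun B => f B ^ 2) I - sumOver 𝓑 f I ^ 2 / sumOver 𝓑 1 I

/-- The family of bases of a matroid of rank `r`. The augmentation property is stated for the
independent sets, which are the sets contained in a member of `𝓑`. -/
structure IsBaseFamily (𝓑 : Finset (Finset α)) (r : ℕ) : Prop where
  card_eq : ∀ B ∈ 𝓑, B.card = r
  augment : ∀ I J : Finset α, (∃ B ∈ 𝓑, I ⊆ B) → (∃ B ∈ 𝓑, J ⊆ B) → I.card < J.card →
    ∃ e ∈ J, e ∉ I ∧ ∃ B ∈ 𝓑, insert e I ⊆ B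

variable {𝓑 : Finset (Finset α)} {r : ℕ}

theorem sumOver_nonneg {f : Finset α → ℝ} (hf : ∀ B, 0 ≤ f B) (I : Finset α) :
    0 ≤ sumOver 𝓑 f I :=
  Finset.sum_nonneg fun B _ => hf B

theorem sumOver_one_nonneg (I : Finset α) : 0 ≤ sumOver 𝓑 1 I :=
  sumOver_nonneg (fun _ => zero_le_one) I

theorem sumOver_one (I : Finset α) : sumOver 𝓑 1 I = ({B ∈ 𝓑 | I ⊆ B}.card : ℝ) := by
  simp [sumOver]

theorem sumOver_one_pos {I : Finset α} : 0 < sumOver 𝓑 1 I ↔ ∃ B ∈ 𝓑, I ⊆ B := by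
  rw [sumOver_one, Nat.cast_pos, Finset.card_pos]
  simp [Finset.Nonempty]

theorem deg_nonneg (I : Finset α) (i : α) : 0 ≤ deg 𝓑 I i := by
  unfold deg; split_ifs; exacts [le_rfl, sumOver_one_nonneg _]

theorem adj_nonneg (I : Finset α) (i j : α) : 0 ≤ adj 𝓑 I i j := by
  unfold adj; split_ifs; exacts [le_rfl, deg_nonneg _ _]

theorem adj_symm (I : Finset α) (i j : α) : adj 𝓑 I i j = adj 𝓑 I j i := by
  by_cases h : i = j
  · rw [h]
  · have h' : j ≠ i := fun h' => h h'.symm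
    by_cases hi : i ∈ I <;> by_cases hj : j ∈ I <;>
      simp [adj, deg, hi, hj, h, h', Finset.insert_comm i j]

theorem deg_insert {I : Finset α} {k : α} (hk : k ∉ I) (i : α) :
    deg 𝓑 (insert k I) i = adj 𝓑 I k i := by
  simp [adj, hk]

/-- Double counting of the pairs of a member of `𝓑` containing `I` and a further element. -/
theorem IsBaseFamily.sum_sumOver_insert [Fintype α] (h : IsBaseFamily 𝓑 r) {I : Finset α} {m : ℕ}
    (hI : I.card + m = r) (f : Finset α → ℝ) :
    ∑ k, (if k ∈ I then 0 else sumOver 𝓑 f (insert k I)) = m * sumOver 𝓑 f I := by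
  have h1 : ∀ k, (if k ∈ I then 0 else sumOver 𝓑 f (insert k I)) =
      ∑ B ∈ 𝓑 with I ⊆ B, if k ∈ B \ I then f B else 0 := by
    intro k
    by_cases hk : k ∈ I
    · simp [hk]
    · simp only [sumOver, hk, if_false, Finset.sum_filter, Finset.insert_subset_iff,
        Finset.mem_sdiff, not_false_eq_true, and_true]
      refine Finset.sum_congr rfl fun B _ => ?_
      by_cases h1 : k ∈ B <;> by_cases h2 : I ⊆ B <;> simp [h1, h2]
  simp_rw [h1]
  rw [Finset.sum_comm, sumOver, Finset.mul_sum]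
  refine Finset.sum_congr rfl fun B hB => ?_
  rw [Finset.mem_filter] at hB
  rw [Finset.sum_ite_mem, Finset.univ_inter, Finset.sum_const, nsmul_eq_mul,
    Finset.card_sdiff_of_subset hB.2, h.card_eq B hB.1, ← hI, Nat.add_sub_cancel_left]

theorem IsBaseFamily.sum_deg [Fintype α] (h : IsBaseFamily 𝓑 r) {I : Finset α} {m : ℕ}
    (hI : I.card + m = r) : ∑ k, deg 𝓑 I k = m * sumOver 𝓑 1 I :=
  h.sum_sumOver_insert hI 1

theorem IsBaseFamily.sum_adj [Fintype α] (h : IsBaseFamily 𝓑 r) {I : Finset α} {m : ℕ}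
    (hI : I.card + (m + 1) = r) (i : α) : ∑ j, adj 𝓑 I i j = m * deg 𝓑 I i := by
  by_cases hi : i ∈ I
  · simp [adj, deg, hi]
  · have : (insert i I).card + m = r := by rw [Finset.card_insert_of_notMem hi]; omega
    simp_rw [← deg_insert hi]
    rw [h.sum_deg this]
    simp [deg, hi]

/-- A base containing I, i and j has m further elements k. This reassembles the matrix at I from
those of its links. -/
theorem IsBaseFamily.sum_adj_insert [Fintype α] (h : IsBaseFamily 𝓑 r) {I : Finset α} {m : ℕ}
    (hI : I.card + (m + 2) = r) (i j : α) :
    ∑ k, (if k ∈ I then 0 else adj 𝓑 (insert k I) i j) = m * adj 𝓑 I i j := by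
  by_cases hi : i ∈ I
  · simp [adj, hi]
  by_cases hj : j ∈ I
  · simp [adj, deg, hj]
  by_cases hij : i = j
  · simp [adj, deg, hij]
  have hj' : j ∉ insert i I := by simp [hj, Ne.symm hij]
  have hc : (insert j (insert i I)).card + m = r := by
    rw [Finset.card_insert_of_notMem hj', Finset.card_insert_of_notMem hi]; omega
  have : adj 𝓑 I i j = sumOver 𝓑 1 (insert j (insert i I)) := by
    simp [adj, deg, hi, hj, Ne.symm hij]
  rw [this, ← h.sum_deg hc]
  refine Finset.sum_congr rfl fun k _ => ?_
  by_cases hk : k ∈ I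
  · simp [deg, hk]
  by_cases hki : k = i
  · simp [hki, adj, deg]
  by_cases hkj : k = j
  · simp [hkj, adj, deg]
  have e : insert j (insert i (insert k I)) = insert k (insert j (insert i I)) := by
    rw [Finset.insert_comm i k, Finset.insert_comm j k]
  simp [adj, deg, hk, hki, hkj, hi, hj, Ne.symm hij, Ne.symm hki, Ne.symm hkj, e]

theorem deg_pos {I : Finset α} {i : α} : 0 < deg 𝓑 I i ↔ i ∉ I ∧ ∃ B ∈ 𝓑, insert i I ⊆ B := by
  by_cases hi : i ∈ I
  · simp [deg, hi]
  · simp [deg, hi, sumOver_one_pos]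

theorem adj_pos {I : Finset α} {i j : α} : 0 < adj 𝓑 I i j ↔
    i ∉ I ∧ j ∉ I ∧ j ≠ i ∧ ∃ B ∈ 𝓑, insert j (insert i I) ⊆ B := by
  by_cases hi : i ∈ I
  · simp [adj, hi]
  · simp [adj, hi, deg_pos, and_assoc, and_left_comm]

theorem deg_pos_of_adj_pos {I : Finset α} {i j : α} (h : 0 < adj 𝓑 I i j) : 0 < deg 𝓑 I i := by
  rw [adj_pos] at h
  obtain ⟨hi, -, -, B, hB, hs⟩ := h
  exact deg_pos.2 ⟨hi, B, hB, (Finset.subset_insert _ _).trans hs⟩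

/-- Being parallel is a transitive relation. -/
theorem IsBaseFamily.adj_pos_or (h : IsBaseFamily 𝓑 r) {I : Finset α} {i j k : α}
    (hik : 0 < adj 𝓑 I i k) (hj : 0 < deg 𝓑 I j) : 0 < adj 𝓑 I i j ∨ 0 < adj 𝓑 I j k := by
  rw [adj_pos] at hik
  obtain ⟨hi, hk, hne, hB⟩ := hik
  obtain ⟨hj, hBj⟩ := deg_pos.1 hj
  have hk' : k ∉ insert i I := by simp [hk, hne]
  -- In the contraction by I, the independent pair {i, k} must augment {j}, by i or by k.
  obtain ⟨e, he, he', hBe⟩ := h.augment (insert j I) (insert k (insert i I)) hBj hB (by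
    rw [Finset.card_insert_of_notMem hk', Finset.card_insert_of_notMem hi,
      Finset.card_insert_of_notMem hj]; omega)
  simp only [Finset.mem_insert, not_or] at he he'
  rcases he with rfl | rfl | he
  · exact .inr (adj_pos.2 ⟨hj, hk, he'.1, hBe⟩)
  · left
    rw [adj_symm]
    exact adj_pos.2 ⟨hj, hi, he'.1, hBe⟩
  · exact absurd he he'.2

/-- The positive row sum gives i a neighbour k, and j is adjacent to i or to k because non-adjacency
is transitive. -/
theorem IsBaseFamily.adj_connected [Fintype α] (h : IsBaseFamily 𝓑 r) {I : Finset α} {m : ℕ}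
    (hI : I.card + (m + 2) = r) {i j : α} (hi : 0 < deg 𝓑 I i) (hj : 0 < deg 𝓑 I j) :
    0 < adj 𝓑 I i j ∨ ∃ k, 0 < adj 𝓑 I i k ∧ 0 < adj 𝓑 I k j := by
  have : 0 < ∑ k, adj 𝓑 I i k := by
    rw [h.sum_adj (m := m + 1) hI]; positivity
  obtain ⟨k, -, hk⟩ : ∃ k ∈ Finset.univ, 0 < adj 𝓑 I i k := by
    by_contra! hcon
    exact this.not_ge (Finset.sum_nonpos hcon)
  rcases h.adj_pos_or hk hj with h' | h'
  · exact .inl h'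
  · exact .inr ⟨k, hk, by rwa [adj_symm]⟩

theorem IsBaseFamily.sumOver_one_le_one (h : IsBaseFamily 𝓑 r) {I : Finset α} (hI : I.card = r) :
    sumOver 𝓑 1 I ≤ 1 := by
  rw [sumOver_one, Nat.cast_le_one, Finset.card_le_one]
  intro B hB B' hB'
  rw [Finset.mem_filter] at hB hB'
  rw [← Finset.eq_of_subset_of_card_le hB.2 (by rw [h.card_eq B hB.1, hI]),
    ← Finset.eq_of_subset_of_card_le hB'.2 (by rw [h.card_eq B' hB'.1, hI])]

/-- In corank two, I ∪ {i, j} already has size r for distinct i, j outside I, so at most one base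
contains it. -/
theorem IsBaseFamily.adj_eq_ite (h : IsBaseFamily 𝓑 r) {I : Finset α} (hI : I.card + 2 = r)
    (i j : α) [Decidable (0 < adj 𝓑 I i j)] :
    adj 𝓑 I i j = if 0 < adj 𝓑 I i j then 1 else 0 := by
  split_ifs with hp
  · obtain ⟨hi, hj, hij, hB⟩ := adj_pos.1 hp
    have hj' : j ∉ insert i I := by simp [hj, hij]
    have e : adj 𝓑 I i j = sumOver 𝓑 1 (insert j (insert i I)) := by
      simp [adj, deg, hi, hj, hij]
    rw [e]
    refine le_antisymm (h.sumOver_one_le_one ?_) ?_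
    · rw [Finset.card_insert_of_notMem hj', Finset.card_insert_of_notMem hi]; omega
    · rw [sumOver_one, Nat.one_le_cast, Nat.one_le_iff_ne_zero, ← Nat.pos_iff_ne_zero,
        ← Nat.cast_pos (α := ℝ), ← sumOver_one, sumOver_one_pos]
      exact hB
  · exact le_antisymm (not_lt.1 hp) (adj_nonneg _ _ _)

/-! ### Negative semidefiniteness on the complement of `deg` -/

open Classical in
/-- In corank two, `adj` is the adjacency matrix of a complete multipartite graph. -/
theorem IsBaseFamily.quadForm_adj_nonpos_two [Fintype α] (h : IsBaseFamily 𝓑 r) {I : Finset α}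
    (hI : I.card + 2 = r) (x : α → ℝ) (hx : ∑ i, deg 𝓑 I i * x i = 0) :
    ∑ i, ∑ j, adj 𝓑 I i j * (x i * x j) ≤ 0 := by
  -- In the contraction by I, `L` marks the non-loops and `R` is parallelism, so `adj` is the
  -- all-ones matrix on non-loops minus the blocks of the parallel classes.
  set L : α → ℝ := fun i => if 0 < deg 𝓑 I i then 1 else 0 with hL
  obtain ⟨R, hR⟩ : ∃ R : α → α → Prop, ∀ i j,
      R i j ↔ 0 < deg 𝓑 I i ∧ 0 < deg 𝓑 I j ∧ ¬ 0 < adj 𝓑 I i j := ⟨_, fun _ _ => Iff.rfl⟩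
  set n : ℝ := ∑ i, L i with hn
  set T : ℝ := ∑ i, L i * x i with hT
  have hadj : ∀ i j, adj 𝓑 I i j = L i * L j - if R i j then 1 else 0 := by
    intro i j
    rw [h.adj_eq_ite hI]
    by_cases hp : 0 < adj 𝓑 I i j
    · have hi := deg_pos_of_adj_pos hp
      have hj := deg_pos_of_adj_pos (adj_symm (𝓑 := 𝓑) I i j ▸ hp)
      simp [hL, hR, hp, hi, hj]
    · by_cases hi : 0 < deg 𝓑 I i <;> by_cases hj : 0 < deg 𝓑 I j <;> simp [hL, hR, hp, hi, hj]
  have hs : ∀ i j, R i j → R j i := fun i j => by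
    rw [hR, hR, adj_symm]; exact fun ⟨h1, h2, h3⟩ => ⟨h2, h1, h3⟩
  have ht : ∀ i j k, R i j → R j k → R i k := fun i j k => by
    simp only [hR]
    exact fun ⟨h1, h2, h3⟩ ⟨_, h5, h6⟩ => ⟨h1, h5, fun h' => (h.adj_pos_or h' h2).elim h3 h6⟩
  have hdeg : ∀ i, deg 𝓑 I i = L i * n - ∑ j, if R i j then (1 : ℝ) else 0 := by
    intro i
    have := h.sum_adj (m := 1) hI i
    rw [Nat.cast_one, one_mul] at this
    rw [← this]
    simp_rw [hadj, Finset.sum_sub_distrib, ← Finset.mul_sum, hn]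
  obtain ⟨hE0, key⟩ := sq_sum_rel_le R hs ht x
  -- Here orthogonality to `deg` enters. Cauchy–Schwarz, with at most n ^ 2 related pairs, then
  -- bounds T ^ 2 by the form of `R`.
  have h1 : ∑ i, ∑ j, (if R i j then x j else 0) = n * T := by
    have : ∑ i, ∑ j, (if R i j then x j else 0) =
        ∑ j, (∑ i, if R j i then (1 : ℝ) else 0) * x j := by
      rw [Finset.sum_comm]
      refine Finset.sum_congr rfl fun j _ => ?_
      rw [Finset.sum_mul]
      refine Finset.sum_congr rfl fun i _ => ?_
      have : R i j ↔ R j i := ⟨hs _ _, hs _ _⟩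
      simp [this]
    have h0 : n * T - ∑ j, (∑ i, if R j i then (1 : ℝ) else 0) * x j = ∑ i, deg 𝓑 I i * x i := by
      rw [hT, Finset.mul_sum, ← Finset.sum_sub_distrib]
      exact Finset.sum_congr rfl fun i _ => by rw [hdeg]; ring
    rw [this]
    linarith
  have h2 : ∑ i, ∑ j, (if R i j then (1 : ℝ) else 0) ≤ n ^ 2 := by
    rw [sq, hn, Finset.sum_mul_sum]
    refine Finset.sum_le_sum fun i _ => Finset.sum_le_sum fun j _ => ?_
    have := hadj i j
    linarith [adj_nonneg (𝓑 := 𝓑) I i j]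
  have h3 : ∑ i, ∑ j, adj 𝓑 I i j * (x i * x j) =
      T ^ 2 - ∑ i, ∑ j, if R i j then x i * x j else 0 := by
    rw [sq, hT, Finset.sum_mul_sum]
    simp_rw [← Finset.sum_sub_distrib]
    refine Finset.sum_congr rfl fun i _ => Finset.sum_congr rfl fun j _ => ?_
    rw [hadj]
    split_ifs <;> ring
  have hn0 : 0 ≤ n := Finset.sum_nonneg fun i _ => by simp only [hL]; split_ifs <;> norm_num
  rw [h3, sub_nonpos]
  rw [h1, mul_pow] at key
  have key' := key.trans (mul_le_mul_of_nonneg_right h2 hE0)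
  rcases hn0.eq_or_lt with hz | hz
  · have hL0 : ∀ i, L i = 0 := fun i => (Finset.sum_eq_zero_iff_of_nonneg fun i _ => by
      simp only [hL]; split_ifs <;> norm_num).1 (hn ▸ hz.symm) i (Finset.mem_univ _)
    have : T = 0 := Finset.sum_eq_zero fun i _ => by rw [hL0, zero_mul]
    rw [this]; simpa using hE0
  · exact le_of_mul_le_mul_left key' (by positivity)

/-- The matrix `adj` has at most one positive eigenvalue. -/
theorem IsBaseFamily.quadForm_adj_nonpos [Fintype α] (h : IsBaseFamily 𝓑 r) (m : ℕ) :
    ∀ {I : Finset α}, I.card + (m + 2) = r → ∀ x : α → ℝ, ∑ i, deg 𝓑 I i * x i = 0 →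
    ∑ i, ∑ j, adj 𝓑 I i j * (x i * x j) ≤ 0 := by
  induction m with
  | zero => exact fun hI x hx => h.quadForm_adj_nonpos_two hI x hx
  | succ m ih =>
    intro I hI x hx
    refine quadForm_nonpos_of_le_sq (adj 𝓑 I) (deg 𝓑 I) (m + 2) (adj_symm I) (adj_nonneg I)
      (deg_nonneg I) (fun i => ?_) (fun y => ?_) (fun i j => h.adj_connected hI) x hx
    · have := h.sum_adj (m := m + 2) hI i
      push_cast at this
      exact this
    have hlocal : ∀ k, (m + 2 : ℝ) * (if k ∈ I then 0 else
        ∑ i, ∑ j, adj 𝓑 (insert k I) i j * (y i * y j)) ≤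
        (m + 1) * ((∑ j, adj 𝓑 I k j * y j) ^ 2 / deg 𝓑 I k) := by
      intro k
      by_cases hk : k ∈ I
      · simp [hk, deg]
      have hc : (insert k I).card + (m + 2) = r := by
        rw [Finset.card_insert_of_notMem hk]; omega
      have hrow : ∀ i, ∑ j, adj 𝓑 (insert k I) i j = (m + 1) * adj 𝓑 I k i := by
        intro i
        have := h.sum_adj (m := m + 1) hc i
        rw [deg_insert hk] at this
        exact_mod_cast this
      have hdk : ∑ j, adj 𝓑 I k j = (m + 2) * deg 𝓑 I k := by
        have := h.sum_adj (m := m + 2) hI k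
        exact_mod_cast this
      simp only [hk, if_false]
      set b : ℝ := ∑ j, adj 𝓑 I k j * y j with hb
      rcases (deg_nonneg (𝓑 := 𝓑) I k).eq_or_lt with h0 | h0
      · have hz : ∀ i, adj 𝓑 I k i = 0 := fun i =>
          (Finset.sum_eq_zero_iff_of_nonneg fun j _ => adj_nonneg I k j).1
            (by rw [hdk, ← h0, mul_zero]) i (Finset.mem_univ _)
        have hz' : ∀ i j, adj 𝓑 (insert k I) i j = 0 := fun i j =>
          (Finset.sum_eq_zero_iff_of_nonneg fun j _ => adj_nonneg _ i j).1
            (by rw [hrow, hz, mul_zero]) j (Finset.mem_univ _)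
        simp [hz', ← h0]
      -- `c` is the mean of y for the weights `adj 𝓑 I k`, which are the degrees in the link of k;
      -- hence y - c is admissible for the induction hypothesis.
      · set c : ℝ := b / ((m + 2) * deg 𝓑 I k) with hcdef
        have hm : (0 : ℝ) < (m + 2) * deg 𝓑 I k := by positivity
        have hih := ih hc (fun i => y i - c) (by
          simp_rw [deg_insert hk, mul_sub, Finset.sum_sub_distrib, ← Finset.sum_mul]
          rw [hdk, ← hb, hcdef, mul_div_cancel₀ _ hm.ne', sub_self])
        have hexp : ∑ i, ∑ j, adj 𝓑 (insert k I) i j * ((y i - c) * (y j - c)) =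
            ∑ i, ∑ j, adj 𝓑 (insert k I) i j * (y i * y j) - (m + 1) * (b ^ 2 /
              ((m + 2) * deg 𝓑 I k)) := by
          have e1 : ∑ i, ∑ j, adj 𝓑 (insert k I) i j * y i = (m + 1) * b := by
            simp_rw [← Finset.sum_mul, hrow, hb, Finset.mul_sum, mul_assoc]
          have e2 : ∑ i, ∑ j, adj 𝓑 (insert k I) i j * y j = (m + 1) * b := by
            rw [Finset.sum_comm, ← e1]
            exact Finset.sum_congr rfl fun i _ => Finset.sum_congr rfl fun j _ => by
              rw [adj_symm]
          have e3 : ∑ i, ∑ j, adj 𝓑 (insert k I) i j = (m + 1) * ((m + 2) * deg 𝓑 I k) := by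
            simp_rw [hrow, ← Finset.mul_sum, hdk]
          calc _ = ∑ i, ∑ j, adj 𝓑 (insert k I) i j * (y i * y j)
                - c * ∑ i, ∑ j, adj 𝓑 (insert k I) i j * y i
                - c * ∑ i, ∑ j, adj 𝓑 (insert k I) i j * y j
                + c ^ 2 * ∑ i, ∑ j, adj 𝓑 (insert k I) i j := by
                simp_rw [Finset.mul_sum, ← Finset.sum_sub_distrib, ← Finset.sum_add_distrib]
                exact Finset.sum_congr rfl fun i _ => Finset.sum_congr rfl fun j _ => by ring
            _ = _ := by
                rw [e1, e2, e3, hcdef]; field_simp; ring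
        rw [hexp, sub_nonpos] at hih
        calc _ ≤ (m + 2 : ℝ) * ((m + 1) * (b ^ 2 / ((m + 2) * deg 𝓑 I k))) := by gcongr
          _ = _ := by field_simp
    have hsum : ∑ k, (if k ∈ I then 0 else ∑ i, ∑ j, adj 𝓑 (insert k I) i j * (y i * y j)) =
        (m + 1) * ∑ i, ∑ j, adj 𝓑 I i j * (y i * y j) := by
      calc _ = ∑ k, ∑ i, ∑ j, (if k ∈ I then 0 else adj 𝓑 (insert k I) i j) * (y i * y j) :=
            Finset.sum_congr rfl fun k _ => by split_ifs <;> simp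
        _ = ∑ i, ∑ j, (∑ k, if k ∈ I then 0 else adj 𝓑 (insert k I) i j) * (y i * y j) := by
            rw [Finset.sum_comm]
            refine Finset.sum_congr rfl fun i _ => ?_
            rw [Finset.sum_comm]
            simp_rw [Finset.sum_mul]
        _ = _ := by
            simp_rw [h.sum_adj_insert (m := m + 1) hI, Finset.mul_sum, mul_assoc]
            push_cast; rfl
    -- Summing over the links and cancelling m + 1 gives P ≤ P ^ 2.
    have htot := Finset.sum_le_sum fun k (_ : k ∈ Finset.univ) => hlocal k
    rw [← Finset.mul_sum, ← Finset.mul_sum, hsum] at htot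
    have hm : (0 : ℝ) < m + 1 := by positivity
    refine le_of_mul_le_mul_left ?_ hm
    linarith

/-! ### Contraction and the Poincaré inequality -/

/-- Summing over bases above elements is adjoint to lifting u from elements to bases. -/
theorem sum_sumOver_insert_mul [Fintype α] (f : Finset α → ℝ) (u : α → ℝ) (I : Finset α) :
    ∑ k, (if k ∈ I then 0 else sumOver 𝓑 f (insert k I)) * u k =
      sumOver 𝓑 (fun B => f B * ∑ k ∈ B \ I, u k) I := by
  have h1 : ∀ k, (if k ∈ I then 0 else sumOver 𝓑 f (insert k I)) * u k =
      ∑ B ∈ 𝓑 with I ⊆ B, f B * if k ∈ B \ I then u k else 0 := by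
    intro k
    by_cases hk : k ∈ I
    · simp [hk]
    · simp only [sumOver, hk, if_false, Finset.sum_filter, Finset.insert_subset_iff,
        Finset.mem_sdiff, not_false_eq_true, and_true, Finset.sum_mul]
      refine Finset.sum_congr rfl fun B _ => ?_
      by_cases h1 : k ∈ B <;> by_cases h2 : I ⊆ B <;> simp [h1, h2]
  simp_rw [h1]
  rw [Finset.sum_comm, sumOver]
  refine Finset.sum_congr rfl fun B _ => ?_
  rw [← Finset.mul_sum, Finset.sum_ite_mem, Finset.univ_inter]

theorem sumOver_eq_zero {I : Finset α} (h : sumOver 𝓑 1 I = 0) (f : Finset α → ℝ) :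
    sumOver 𝓑 f I = 0 := by
  rw [sumOver_one, Nat.cast_eq_zero, Finset.card_eq_zero] at h
  rw [sumOver, h, Finset.sum_empty]

theorem var_nonneg (f : Finset α → ℝ) (I : Finset α) : 0 ≤ var 𝓑 f I := by
  rcases (sumOver_one_nonneg (𝓑 := 𝓑) I).eq_or_lt with h | h
  · simp [var, sumOver_eq_zero h.symm]
  · rw [var, sub_nonneg, div_le_iff₀ h, sumOver_one, mul_comm]
    exact sq_sum_le_card_mul_sum_sq

theorem var_sub_const (f : Finset α → ℝ) (c : ℝ) (I : Finset α) :
    var 𝓑 (fun B => f B - c) I = var 𝓑 f I := by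
  by_cases h : sumOver 𝓑 1 I = 0
  · simp [var, sumOver_eq_zero h]
  · have h1 : sumOver 𝓑 (fun B => f B - c) I = sumOver 𝓑 f I - c * sumOver 𝓑 1 I := by
      simp [sumOver, Finset.sum_sub_distrib, mul_comm]
    have h2 : sumOver 𝓑 (fun B => (f B - c) ^ 2) I =
        sumOver 𝓑 (fun B => f B ^ 2) I - 2 * c * sumOver 𝓑 f I + c ^ 2 * sumOver 𝓑 1 I := by
      simp only [sumOver, Finset.mul_sum, ← Finset.sum_sub_distrib, ← Finset.sum_add_distrib]
      exact Finset.sum_congr rfl fun B _ => by simp only [Pi.one_apply]; ring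
    rw [var, var, h1, h2]
    field_simp
    ring

/-- The averaging operator from members of `𝓑` to elements contracts functions of mean zero by
the factor `1 / (m + 2)`. -/
theorem IsBaseFamily.sum_sq_div_deg_le [Fintype α] (h : IsBaseFamily 𝓑 r) {I : Finset α} {m : ℕ}
    (hI : I.card + (m + 2) = r) (f : Finset α → ℝ) (hf : sumOver 𝓑 f I = 0) :
    ∑ k, (if k ∈ I then 0 else sumOver 𝓑 f (insert k I)) ^ 2 / deg 𝓑 I k ≤
      sumOver 𝓑 (fun B => f B ^ 2) I := by
  set G : α → ℝ := fun k => if k ∈ I then 0 else sumOver 𝓑 f (insert k I) with hG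
  set g : α → ℝ := fun k => G k / deg 𝓑 I k with hg
  set S := ∑ k, G k ^ 2 / deg 𝓑 I k with hS
  have hG0 : ∀ k, deg 𝓑 I k = 0 → G k = 0 := by
    intro k hk
    by_cases hkI : k ∈ I
    · simp [hG, hkI]
    · simp only [deg, hkI, if_false] at hk
      simp [hG, hkI, sumOver_eq_zero hk]
  have hdg : ∀ k, deg 𝓑 I k * g k = G k := by
    intro k
    by_cases hk : deg 𝓑 I k = 0
    · rw [hk, hG0 k hk, zero_mul]
    · exact mul_div_cancel₀ _ hk
  -- `H` lifts the averages `g` back to bases. Then S = ⟨f, H⟩ and ‖H‖² = S + gᵀ adj g ≤ S, so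
  -- Cauchy–Schwarz gives S² ≤ ‖f‖² S.
  set H : Finset α → ℝ := fun B => ∑ k ∈ B \ I, g k with hH
  have hS1 : S = sumOver 𝓑 (fun B => f B * H B) I := by
    rw [← sum_sumOver_insert_mul]
    exact Finset.sum_congr rfl fun k _ => by simp only [hG, hg]; ring
  have hS2 : sumOver 𝓑 (fun B => H B ^ 2) I ≤ S := by
    have hstep : ∀ k, (if k ∈ I then 0 else sumOver 𝓑 H (insert k I)) =
        deg 𝓑 I k * g k + ∑ j, adj 𝓑 I k j * g j := by
      intro k
      by_cases hk : k ∈ I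
      · simp [hk, deg, adj]
      have e : ∑ j, adj 𝓑 I k j * g j =
          sumOver 𝓑 (fun B => ∑ j ∈ B \ insert k I, g j) (insert k I) := by
        have := sum_sumOver_insert_mul (𝓑 := 𝓑) 1 g (insert k I)
        simp only [Pi.one_apply, one_mul] at this
        rw [← this]
        simp_rw [← deg_insert hk, deg]
      rw [e]
      simp only [hk, if_false, deg, sumOver, Finset.sum_mul, ← Finset.sum_add_distrib]
      refine Finset.sum_congr rfl fun B hB => ?_
      rw [Finset.mem_filter, Finset.insert_subset_iff] at hB
      have : B \ I = insert k (B \ insert k I) := by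
        ext a
        by_cases ha : a = k
        · simp [ha, hB.2.1, hk]
        · simp [ha]
      rw [hH, Pi.one_apply, one_mul]
      simp only
      rw [this, Finset.sum_insert (by simp)]
    have hgm : ∑ k, deg 𝓑 I k * g k = 0 := by
      simp_rw [hdg]
      rw [h.sum_sumOver_insert hI, hf, mul_zero]
    have hneg := h.quadForm_adj_nonpos m hI g hgm
    have : sumOver 𝓑 (fun B => H B ^ 2) I = S + ∑ i, ∑ j, adj 𝓑 I i j * (g i * g j) := by
      simp_rw [sq (H _)]
      rw [← sum_sumOver_insert_mul, hS, ← Finset.sum_add_distrib]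
      refine Finset.sum_congr rfl fun k _ => ?_
      rw [hstep, add_mul, Finset.sum_mul, hdg]
      congr 1
      · simp only [hg]; ring
      · exact Finset.sum_congr rfl fun j _ => by ring
    linarith
  have hcs : S ^ 2 ≤ sumOver 𝓑 (fun B => f B ^ 2) I * sumOver 𝓑 (fun B => H B ^ 2) I := by
    rw [hS1]
    exact Finset.sum_mul_sq_le_sq_mul_sq _ _ _
  have hf0 : 0 ≤ sumOver 𝓑 (fun B => f B ^ 2) I := sumOver_nonneg (fun B => sq_nonneg _) I
  have hS0 : 0 ≤ S := Finset.sum_nonneg fun k _ => div_nonneg (sq_nonneg _) (deg_nonneg I k)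
  rcases hS0.eq_or_lt with h0 | h0
  · rwa [← h0]
  · have := hcs.trans (mul_le_mul_of_nonneg_left hS2 hf0)
    rw [sq] at this
    exact le_of_mul_le_mul_right this h0

/-- Law of total variance: for centred f the link variances add up to (m + 2) ‖f‖², as each base
lies in m + 2 links, minus a term that the contraction bounds by ‖f‖². -/
theorem IsBaseFamily.mul_var_le_sum_var_insert [Fintype α] (h : IsBaseFamily 𝓑 r) {I : Finset α}
    {m : ℕ} (hI : I.card + (m + 2) = r) (f : Finset α → ℝ) :
    (m + 1) * var 𝓑 f I ≤ ∑ k, if k ∈ I then 0 else var 𝓑 f (insert k I) := by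
  rcases (sumOver_one_nonneg (𝓑 := 𝓑) I).eq_or_lt with h0 | h0
  · have : var 𝓑 f I = 0 := by simp [var, sumOver_eq_zero h0.symm]
    rw [this, mul_zero]
    exact Finset.sum_nonneg fun k _ => by split_ifs; exacts [le_rfl, var_nonneg _ _]
  set c := sumOver 𝓑 f I / sumOver 𝓑 1 I with hc
  rw [← var_sub_const f c I]
  simp_rw [← var_sub_const f c (insert _ I)]
  set f' : Finset α → ℝ := fun B => f B - c with hf'
  have hmean : sumOver 𝓑 f' I = 0 := by
    have : sumOver 𝓑 f' I = sumOver 𝓑 f I - c * sumOver 𝓑 1 I := by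
      simp [sumOver, hf', Finset.sum_sub_distrib, mul_comm]
    rw [this, hc, div_mul_cancel₀ _ h0.ne', sub_self]
  have hsplit : ∑ k, (if k ∈ I then 0 else var 𝓑 f' (insert k I)) =
      (m + 2) * sumOver 𝓑 (fun B => f' B ^ 2) I -
      ∑ k, (if k ∈ I then 0 else sumOver 𝓑 f' (insert k I)) ^ 2 / deg 𝓑 I k := by
    have := h.sum_sumOver_insert hI fun B => f' B ^ 2
    push_cast at this
    rw [← this, ← Finset.sum_sub_distrib]
    refine Finset.sum_congr rfl fun k _ => ?_
    by_cases hk : k ∈ I <;> simp [hk, var, deg]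
  rw [hsplit, var, hmean]
  have := h.sum_sq_div_deg_le hI f' hmean
  simp only [ne_eq, OfNat.ofNat_ne_zero, not_false_eq_true, zero_pow, zero_div, sub_zero]
  linarith

/-- The Poincaré inequality for the bases exchange walk. -/
theorem IsBaseFamily.var_le_sum_var [Fintype α] (h : IsBaseFamily 𝓑 r) (f : Finset α → ℝ) (m : ℕ) :
    ∀ {I : Finset α}, I.card + (m + 1) = r →
    var 𝓑 f I ≤ ∑ J : Finset α, if I ⊆ J ∧ J.card + 1 = r then var 𝓑 f J else 0 := by
  have hnn : ∀ I J : Finset α, 0 ≤ if I ⊆ J ∧ J.card + 1 = r then var 𝓑 f J else 0 :=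
    fun I J => by split_ifs; exacts [var_nonneg _ _, le_rfl]
  induction m with
  | zero =>
    intro I hI
    refine le_trans ?_ (Finset.single_le_sum (fun J _ => hnn I J) (Finset.mem_univ I))
    rw [if_pos ⟨subset_rfl, hI⟩]
  | succ m ih =>
    intro I hI
    have h1 : ∀ k, (if k ∈ I then 0 else var 𝓑 f (insert k I)) ≤
        ∑ J : Finset α, if k ∈ J \ I then
          (if I ⊆ J ∧ J.card + 1 = r then var 𝓑 f J else 0) else 0 := by
      intro k
      by_cases hk : k ∈ I
      · simp [hk]
      · have hc : (insert k I).card + (m + 1) = r := by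
          rw [Finset.card_insert_of_notMem hk]; omega
        simp only [hk, if_false]
        refine (ih hc).trans_eq (Finset.sum_congr rfl fun J _ => ?_)
        by_cases hkJ : k ∈ J <;> simp [hk, hkJ, Finset.insert_subset_iff]
    have h2 := (h.mul_var_le_sum_var_insert hI f).trans
      (Finset.sum_le_sum fun k _ => h1 k)
    rw [Finset.sum_comm] at h2
    have hm : (0 : ℝ) < m + 1 := by positivity
    refine le_of_mul_le_mul_left (h2.trans_eq ?_) hm
    rw [Finset.mul_sum]
    refine Finset.sum_congr rfl fun J _ => ?_
    -- Each J of size r - 1 is reached through the m + 1 elements of J \ I, which matches the factor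
    -- on the left.
    rw [Finset.sum_ite_mem, Finset.univ_inter, Finset.sum_const, nsmul_eq_mul]
    by_cases hJ : I ⊆ J ∧ J.card + 1 = r
    · rw [Finset.card_sdiff_of_subset hJ.1, show J.card - I.card = m + 1 by omega]
      push_cast; rfl
    · simp [hJ]

/-! ### From variance to the cut -/

/-- The expansion inequality for a family of bases. -/
theorem IsBaseFamily.card_le_card_cut [Fintype α] (h : IsBaseFamily 𝓑 r) {S : Finset (Finset α)}
    (hS : S ⊆ 𝓑) (hcard : S.card ≤ (𝓑 \ S).card) :
    S.card ≤ {p ∈ S ×ˢ (𝓑 \ S) | (p.1 ∩ p.2).card + 1 = r}.card := by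
  rcases Nat.eq_zero_or_pos S.card with hS0 | hS0
  · simp [hS0]
  rcases r with _ | r
  -- In rank zero the empty set is the only possible base, so S and its complement cannot both be
  -- nonempty.
  · exfalso
    obtain ⟨B, hB⟩ := Finset.card_pos.1 hS0
    obtain ⟨B', hB'⟩ := Finset.card_pos.1 (hS0.trans_le hcard)
    rw [Finset.mem_sdiff] at hB'
    have h1 := Finset.card_eq_zero.1 (h.card_eq B (hS hB))
    have h2 := Finset.card_eq_zero.1 (h.card_eq B' hB'.1)
    exact hB'.2 (h2 ▸ h1 ▸ hB)
  set f : Finset α → ℝ := fun B => if B ∈ S then 1 else 0 with hf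
  set s : Finset α → ℕ := fun J => {B ∈ S | J ⊆ B}.card with hs
  set t : Finset α → ℕ := fun J => {B ∈ 𝓑 \ S | J ⊆ B}.card with ht
  have hfs : ∀ J, sumOver 𝓑 f J = s J := by
    intro J
    simp only [sumOver, hf, hs, Finset.sum_boole, Finset.filter_filter]
    congr 2
    ext B
    simp only [Finset.mem_filter]
    exact ⟨fun h => ⟨h.2.2, h.2.1⟩, fun h => ⟨hS h.1, h.2, h.1⟩⟩
  have hfs2 : ∀ J, sumOver 𝓑 (fun B => f B ^ 2) J = s J := by
    intro J
    rw [← hfs]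
    congr 1
    ext B
    simp [hf]
  have hst : ∀ J, sumOver 𝓑 1 J = s J + t J := by
    intro J
    rw [sumOver_one, hs, ht, ← Nat.cast_add, ← Finset.card_union_of_disjoint, ← Finset.filter_union,
      Finset.union_sdiff_of_subset hS]
    exact Finset.disjoint_filter_filter Finset.disjoint_sdiff
  have hvar : ∀ J, var 𝓑 f J = s J - (s J : ℝ) ^ 2 / (s J + t J) := by
    intro J
    rw [var, hfs, hfs2, hst]
  -- The variance vanishes unless s and t are both at least 1, and then s + t ≥ 2.
  have hup : ∀ J, var 𝓑 f J ≤ (s J * t J : ℕ) / 2 := by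
    intro J
    rw [hvar]
    rcases Nat.eq_zero_or_pos (s J) with h0 | h0
    · simp [h0]
    rcases Nat.eq_zero_or_pos (t J) with h1 | h1
    · have : (s J : ℝ) ≠ 0 := by positivity
      simp only [h1, Nat.cast_zero, add_zero, mul_zero, zero_div]
      rw [sq, mul_div_assoc, div_self this, mul_one, sub_self]
    · have h0' : (1 : ℝ) ≤ s J := by exact_mod_cast h0
      have h1' : (1 : ℝ) ≤ t J := by exact_mod_cast h1
      have e : (s J : ℝ) - (s J : ℝ) ^ 2 / (s J + t J) = s J * t J / (s J + t J) := by
        field_simp; ring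
      rw [e, Nat.cast_mul]
      gcongr
      linarith
  have hlow : (S.card : ℝ) / 2 ≤ var 𝓑 f ∅ := by
    have e1 : s ∅ = S.card := by simp [hs]
    have e2 : t ∅ = (𝓑 \ S).card := by simp [ht]
    have h1 : (S.card : ℝ) ≤ (𝓑 \ S).card := by exact_mod_cast hcard
    have h2 : (0 : ℝ) < S.card := by exact_mod_cast hS0
    rw [hvar, e1, e2, div_le_iff₀ two_pos, sub_mul, div_mul_eq_mul_div, le_sub_comm,
      div_le_iff₀ (by positivity)]
    nlinarith
  have hpoin := h.var_le_sum_var f r (I := ∅) (by simp)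
  have hcount : ∑ J : Finset α, (if J.card + 1 = r + 1 then s J * t J else 0) ≤
      {p ∈ S ×ˢ (𝓑 \ S) | (p.1 ∩ p.2).card + 1 = r + 1}.card := by
    have e : ∀ J : Finset α, (if J.card + 1 = r + 1 then s J * t J else 0) =
        ∑ p ∈ S ×ˢ (𝓑 \ S), if J.card = r ∧ J ⊆ p.1 ∩ p.2 then 1 else 0 := by
      intro J
      by_cases hJ : J.card = r
      · simp only [hJ, if_true, true_and, hs, ht, ← Finset.card_product, ← Finset.filter_product,
          Finset.sum_boole, Finset.subset_inter_iff, Nat.cast_id]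
      · simp [hJ]
    simp_rw [e]
    rw [Finset.sum_comm, Finset.card_filter]
    refine Finset.sum_le_sum fun p hp => ?_
    rw [Finset.mem_product, Finset.mem_sdiff] at hp
    -- Distinct bases of size r + 1 share at most r elements, so a set J of size r inside both must
    -- be their intersection.
    have hlt : (p.1 ∩ p.2).card ≤ r := by
      by_contra! hlt
      have c1 := h.card_eq _ (hS hp.1)
      have c2 := h.card_eq _ hp.2.1
      have e1 := Finset.eq_of_subset_of_card_le (Finset.inter_subset_left (s₁ := p.1) (s₂ := p.2))
        (by omega)
      have e2 := Finset.eq_of_subset_of_card_le (Finset.inter_subset_right (s₁ := p.1) (s₂ := p.2))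
        (by omega)
      exact hp.2.2 (e2 ▸ e1.symm ▸ hp.1)
    have hJ : ∀ J : Finset α, J.card = r ∧ J ⊆ p.1 ∩ p.2 → J = p.1 ∩ p.2 := fun J hJ =>
      Finset.eq_of_subset_of_card_le hJ.2 (by omega)
    rw [← Finset.card_filter]
    split_ifs with hr
    · rw [Finset.card_le_one]
      intro J hJ1 J' hJ2
      rw [hJ J (Finset.mem_filter.1 hJ1).2, hJ J' (Finset.mem_filter.1 hJ2).2]
    · rw [Nat.le_zero, Finset.card_eq_zero, Finset.filter_eq_empty_iff]
      intro J _ hJ'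
      exact hr (by rw [← hJ J hJ', hJ'.1])
  have hfin : (S.card : ℝ) / 2 ≤
      ((∑ J : Finset α, (if J.card + 1 = r + 1 then s J * t J else 0) : ℕ) : ℝ) / 2 := by
    refine (hlow.trans hpoin).trans ?_
    rw [Nat.cast_sum, Finset.sum_div]
    refine Finset.sum_le_sum fun J _ => ?_
    by_cases hJ : J.card + 1 = r + 1
    · simpa [hJ] using hup J
    · simp [show J.card ≠ r by omega]
  have : (S.card : ℝ) ≤
      ((∑ J : Finset α, (if J.card + 1 = r + 1 then s J * t J else 0) : ℕ) : ℝ) := by linarith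
  exact (Nat.cast_le.1 this).trans hcount

end BaseFamily

/-! ### Transfer to matroids -/

open Classical in
/-- The bases of a matroid, as finite subsets of the ground set, form a family of bases. -/
theorem Matroid.isBaseFamily {α : Type*} (M : Matroid α) [Fintype M.E] {B₀ : Set α}
    (hB₀ : M.IsBase B₀) :
    BaseFamily.IsBaseFamily
      {B : Finset M.E | M.IsBase (Subtype.val '' (B : Set M.E))} B₀.ncard := by
  have hcard : ∀ I : Finset M.E, (Subtype.val '' (I : Set M.E)).ncard = I.card := fun I => by
    rw [Set.ncard_image_of_injective _ Subtype.val_injective, Set.ncard_coe_finset]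
  have hind : ∀ I : Finset M.E, (∃ B ∈ ({B : Finset M.E | M.IsBase (Subtype.val '' (B : Set M.E))} :
      Finset (Finset M.E)), I ⊆ B) ↔ M.Indep (Subtype.val '' (I : Set M.E)) := by
    intro I
    constructor
    · rintro ⟨B, hB, hIB⟩
      exact (Finset.mem_filter.1 hB).2.indep.subset (Set.image_mono (by exact_mod_cast hIB))
    · intro hI
      obtain ⟨B, hB, hIB⟩ := hI.exists_isBase_superset
      refine ⟨(Subtype.val ⁻¹' B : Set M.E).toFinset, ?_, ?_⟩
      · simpa [Set.inter_eq_self_of_subset_right hB.subset_ground] using hB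
      · intro x hx
        simpa using hIB ⟨x, hx, rfl⟩
  refine ⟨fun B hB => ?_, fun I J hI hJ hIJ => ?_⟩
  · rw [← hcard]
    exact (Finset.mem_filter.1 hB).2.ncard_eq_ncard_of_isBase hB₀
  · rw [hind] at hI hJ
    obtain ⟨e, ⟨⟨e, he, rfl⟩, heI⟩, hins⟩ := hI.augment hJ (by
      rw [← Set.Finite.cast_ncard_eq (Set.toFinite _), ← Set.Finite.cast_ncard_eq (Set.toFinite _),
        hcard, hcard]
      exact_mod_cast hIJ)
    refine ⟨e, he, fun h => heI ⟨e, h, rfl⟩, (hind _).2 ?_⟩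
    rwa [Finset.coe_insert, Set.image_insert_eq]

open Classical in
theorem Matroid.ncard_le_ncard_cutEdges {α : Type*} (M : Matroid α) [M.Finite]
    (S : Set {B : Set α // M.IsBase B}) (hS : S.ncard ≤ Sᶜ.ncard) :
    S.ncard ≤ (M.basesExchangeGraph.cutEdges S).ncard := by
  have := M.ground_finite.fintype
  have := Fintype.ofFinite {B : Set α // M.IsBase B}
  obtain ⟨B₀, hB₀⟩ := M.exists_isBase
  have hfam := M.isBaseFamily hB₀
  have himg : ∀ B : {B : Set α // M.IsBase B},
      Subtype.val '' (Subtype.val ⁻¹' B.1 : Set M.E) = B.1 := fun B => by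
    simpa using B.2.subset_ground
  let φ : {B : Set α // M.IsBase B} ↪ Finset M.E :=
    ⟨fun B => (Subtype.val ⁻¹' B.1 : Set M.E).toFinset, fun B B' h => by
      rw [Set.toFinset_inj] at h
      exact Subtype.ext (by rw [← himg B, h, himg B'])⟩
  have hφ : ∀ B, (Subtype.val '' (φ B : Set M.E)) = B.1 := fun B => by
    rw [← himg B]
    exact congrArg _ (Set.coe_toFinset _)
  have huniv : ({B : Finset M.E | M.IsBase (Subtype.val '' (B : Set M.E))} : Finset (Finset M.E)) =
      Finset.univ.map φ := by
    ext B
    simp only [Finset.mem_filter, Finset.mem_univ, true_and, Finset.mem_map]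
    constructor
    · intro hB
      refine ⟨⟨_, hB⟩, ?_⟩
      rw [← Finset.coe_inj]
      exact Set.image_injective.2 Subtype.val_injective (hφ _)
    · rintro ⟨B, rfl⟩
      rw [hφ]; exact B.2
  rw [huniv] at hfam
  set s := S.toFinset with hs
  have hsd : Finset.univ.map φ \ s.map φ = sᶜ.map φ := by
    rw [← Finset.map_sdiff, Finset.compl_eq_univ_sdiff]
  have hsS : S.ncard = s.card := Set.ncard_eq_toFinset_card' S
  have hsS' : Sᶜ.ncard = sᶜ.card := by rw [Set.ncard_eq_toFinset_card', Set.toFinset_compl]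
  have key := hfam.card_le_card_cut (S := s.map φ) (Finset.map_subset_map.2 (Finset.subset_univ _))
    (by rw [hsd, Finset.card_map, Finset.card_map, ← hsS, ← hsS']; exact hS)
  rw [hsd, Finset.card_map, ← Finset.prodMap_map_product, Finset.filter_map, Finset.card_map] at key
  rw [hsS]
  refine key.trans ?_
  rw [← Set.ncard_coe_finset]
  -- An edge determines its ordered pair, because only the first entry lies in S.
  refine Set.ncard_le_ncard_of_injOn (fun p => s(p.1, p.2)) ?_ ?_ (Set.toFinite _)
  · rintro ⟨B, B'⟩ hp
    simp only [Finset.coe_filter, Finset.mem_product, Function.comp_apply, Set.mem_ofPred_eq,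
      Finset.mem_compl, hs, Set.mem_toFinset] at hp
    refine ⟨?_, B, hp.1.1, B', hp.1.2, rfl⟩
    change ((B : Set α) ∆ (B' : Set α)).encard = 2
    have hc : (φ B ∩ φ B').card + 1 = B₀.ncard := hp.2
    have hr : ∀ B, (φ B).card = B₀.ncard := fun B =>
      hfam.card_eq _ (Finset.mem_map_of_mem φ (Finset.mem_univ B))
    have h1 : ((φ B) \ (φ B')).card = 1 := by
      have := Finset.card_sdiff_add_card_inter (φ B) (φ B')
      have := hr B
      omega
    have h2 : ((φ B') \ (φ B)).card = 1 := by
      have := Finset.card_sdiff_add_card_inter (φ B') (φ B)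
      have := hr B'
      rw [Finset.inter_comm] at hc
      omega
    rw [← hφ B, ← hφ B', Set.symmDiff_def, ← Set.image_sdiff Subtype.val_injective,
      ← Set.image_sdiff Subtype.val_injective, ← Set.image_union,
      Subtype.val_injective.encard_image, Set.encard_union_eq disjoint_sdiff_sdiff,
      ← Finset.coe_sdiff, ← Finset.coe_sdiff, Set.encard_coe_eq_coe_finsetCard,
      Set.encard_coe_eq_coe_finsetCard, h1, h2]
    norm_num
  · rintro ⟨B, B'⟩ hp ⟨C, C'⟩ hq h
    simp only [Finset.coe_filter, Finset.mem_product, Set.mem_ofPred_eq, Finset.mem_compl, hs,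
      Set.mem_toFinset] at hp hq
    rcases Sym2.eq_iff.1 h with ⟨rfl, rfl⟩ | ⟨rfl, rfl⟩
    · rfl
    · exact absurd hp.1.1 hq.1.2

theorem theorem1p5 {α : Type*} (M : Matroid α) [M.Finite] :
    1 ≤ M.basesExchangeGraph.expansion := by
  refine le_iInf fun S => le_iInf fun hS => le_iInf fun hcard => ?_
  rw [ENNReal.one_le_coe_iff, SimpleGraph.setExpansion, one_le_div (by
    rw [Nat.cast_pos, Set.ncard_pos]; exact hS)]
  exact_mod_cast M.ncard_le_ncard_cutEdges S hcard
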